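/- Let $G$ be a finitely generated amenable group, equipped with the left-invariant word metric $d$ of a finite generating set, let $B_r=\{g\in G: d(e,g)\le r\}$, and let $A$ be a finite discrete alphabet. Let $\mathfrak S=\mathfrak S(G,A)$ be the space of all shifts, i.e. nonempty closed subsets $X\subseteq A^G$ (product topology) that are invariant under $[gx](h)=x(g^{-1}h)$, equipped with the Hausdorff topology. For a finite $K\subset G$ let $X_K=\{x|_K: x\in X\}$. For a nonempty finite $F\subset G$ and $r\in\mathbb N$ let $\partial_rF=\{g\in G: gB_r\cap F\ne\emptyset,\ gB_r\cap(G\setminus F)\neq\emptyset\}$. A Følner sequence is a sequence $(F_n)$ of nonempty finite subsets of $G$ with $\lim_n|\partial_rF_n|/|F_n|=0$ for every $r\in\mathbb N$. Then Følner sequences exist; for every $X\in\mathfrak S$ the limit $$h(X)=\lim_{n\to\infty}\frac1{|F_n|}\log|X_{F_n}|$$ exists in $[0,\infty)$ for every Følner sequence $(F_n)$ and does not depend on the sequence; and the entropy map $h\colon\mathfrak S\to[0,\infty)$ is upper semi-continuous. (Amenability is understood as Følner's condition: for every finite $K\subset G$ and $\varepsilon>0$ there is a nonempty finite $F\subset G$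 with $|Fk\,\triangle\,F|\le\varepsilon|F|$ for all $k\in K$.) -/

import Mathlib

open Filter Topology

noncomputable section

namespace ShiftEntropy

/-! ### The word metric, boundaries, and Følner sequences -/

section Group

variable {G : Type*} [Group G]

/-- The word length of `g` with respect to `S`: the least length of a word in the letters
`s, s⁻¹` (`s ∈ S`) that represents `g`. -/
def wordLength (S : Finset G) (g : G) : ℕ :=
  sInf {n | ∃ l : List G, l.length = n ∧ (∀ x ∈ l, x ∈ S ∨ x⁻¹ ∈ S) ∧ l.prod = g}

/-- The left-invariant word metric. -/
def wordDist (S : Finset G) (g h : G) : ℕ := wordLength S (g⁻¹ * h)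

/-- The ball of radius `r` around the identity. -/
def ball (S : Finset G) (r : ℕ) : Set G := {g | wordDist S 1 g ≤ r}

/-- The `r`-boundary of `F`: those `g` whose translated ball `g B_r` meets both `F` and its
complement. -/
def boundary (S : Finset G) (r : ℕ) (F : Finset G) : Set G :=
  {g | (∃ b ∈ ball S r, g * b ∈ F) ∧ ∃ b ∈ ball S r, g * b ∉ F}

/-- The `r`-boundary ratio `|∂_r F| / |F|`. -/
def boundaryRatio (S : Finset G) (r : ℕ) (F : Finset G) : ℝ :=
  ((boundary S r F).ncard : ℝ) / (F.card : ℝ)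

/-- A Følner sequence: nonempty finite sets whose `r`-boundary ratio tends to `0` for each `r`. -/
def IsFolner (S : Finset G) (F : ℕ → Finset G) : Prop :=
  (∀ n, (F n).Nonempty) ∧ ∀ r : ℕ, Tendsto (fun n => boundaryRatio S r (F n)) atTop (𝓝 0)

end Group

open Classical in
/-- Amenability of a discrete group, as Følner's condition: for all finite `K` and `ε > 0` there
is a nonempty finite `F` with `|F k ∆ F| ≤ ε |F|` for all `k ∈ K`. -/
def IsAmenable (G : Type*) [Group G] : Prop :=
  ∀ K : Finset G, ∀ ε : ℝ, 0 < ε → ∃ F : Finset G, F.Nonempty ∧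
    ∀ k ∈ K, ((symmDiff (F.image (fun g => g * k)) F).card : ℝ) ≤ ε * (F.card : ℝ)

/-! ### Shifts and entropy -/

/-- The shift action of `G` on `A^G`: `(g x)(h) = x (g⁻¹ h)`. -/
def shiftBy {G A : Type*} [Group G] (g : G) (x : G → A) : G → A := fun h => x (g⁻¹ * h)

/-- The space of shifts: nonempty closed (equivalently compact, when `A` is finite) shift-invariant
subsets of `A^G`. As a subtype of `NonemptyCompacts (G → A)` it carries the Hausdorff (Vietoris)
topology. -/
abbrev Shift (G A : Type*) [Group G] [TopologicalSpace A] : Type _ :=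
  {X : TopologicalSpace.NonemptyCompacts (G → A) // ∀ g : G, ∀ x ∈ X, shiftBy g x ∈ X}

section Entropy

variable {G A : Type*} [Group G] [TopologicalSpace A]

/-- The projection `X_K` of a shift to a finite set `K`. -/
def proj (X : Shift G A) (K : Finset G) : Set (K → A) :=
  K.restrict '' (X.1 : Set (G → A))

/-- `log |X_K| / |K|`. -/
def entropyRate (X : Shift G A) (K : Finset G) : ℝ :=
  1 / (K.card : ℝ) * Real.log ((proj X K).ncard : ℝ)

/-- The entropy of `X`: the number that is the limit of `log |X_{F_n}| / |F_n|` along every Følner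
sequence `F`. -/
def entropy (S : Finset G) (X : Shift G A) : ℝ :=
  Classical.epsilon fun h : ℝ =>
    ∀ F : ℕ → Finset G, IsFolner S F → Tendsto (fun n => entropyRate X (F n)) atTop (𝓝 h)

end Entropy

end ShiftEntropy

end

/-! The entropy is the infimum of `entropyRate X E` over all nonempty finite `E`, and both the limit
and semicontinuity follow from this. The key is Shearer's inequality applied to the sets `gE ∩ F`:
they cover each point of `F` exactly `|E|` times, so `|X_F|^|E|` is at most the product of the
`|X_{gE ∩ F}|`. At most `|F|` translates lie inside `F`, each contributing at most `|X_E|` by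
invariance; the rest are indexed by `∂_r F` and contribute at most `|A|^|E|`. Hence
`entropyRate_le_add`, whose error vanishes along Følner sequences. For fixed `E` the rate cannot
increase near `X`, so the infimum is upper semicontinuous. -/

namespace ShiftEntropy

/-! ### Shearer's inequality for projections -/

section Shearer

/-- The arithmetic-geometric mean inequality, for unweighted finite products. -/
theorem prod_le_mean_pow {ι : Type*} (J : Finset ι) (hJ : J.Nonempty) (z : ι → ℝ)
    (hz : ∀ i ∈ J, 0 ≤ z i) :
    ∏ i ∈ J, z i ≤ ((J.card : ℝ)⁻¹ * ∑ i ∈ J, z i) ^ J.card := by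
  have hk : (J.card : ℝ) ≠ 0 := by exact_mod_cast hJ.card_pos.ne'
  have h := Real.geom_mean_le_arith_mean_weighted J (fun _ => (J.card : ℝ)⁻¹) z
    (fun _ _ => by positivity) (by simp [hk]) hz
  rw [← Finset.mul_sum] at h
  have h2 := pow_le_pow_left₀
    (Finset.prod_nonneg fun i hi => Real.rpow_nonneg (hz i hi) _) h J.card
  rw [← Finset.prod_pow] at h2
  refine le_trans (le_of_eq (Finset.prod_congr rfl fun i hi => ?_)) h2
  rw [Real.rpow_inv_natCast_pow (hz i hi) hJ.card_pos.ne']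

/-- A form of the generalized Hölder inequality. -/
theorem sum_pow_le_mul_prod_sum {ι α : Type*} (J : Finset ι) (hJ : J.Nonempty) (s : Finset α)
    (x : α → ℝ) (c : ι → α → ℝ) (C : ℝ) (hx : ∀ a ∈ s, 0 ≤ x a) (hc : ∀ i a, 0 ≤ c i a)
    (hC : 0 ≤ C) (h : ∀ a ∈ s, x a ^ J.card ≤ C * ∏ i ∈ J, c i a) :
    (∑ a ∈ s, x a) ^ J.card ≤ C * ∏ i ∈ J, ∑ a ∈ s, c i a := by
  have hk : J.card ≠ 0 := hJ.card_pos.ne'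
  have hkR : (J.card : ℝ) ≠ 0 := by exact_mod_cast hk
  set T : ι → ℝ := fun i => ∑ a ∈ s, c i a with hT
  have hT0 : ∀ i, 0 ≤ T i := fun i => Finset.sum_nonneg fun a _ => hc i a
  have hP : 0 ≤ C * ∏ i ∈ J, T i := mul_nonneg hC (Finset.prod_nonneg fun i _ => hT0 i)
  rcases hP.eq_or_lt with h0 | hpos
  · have : ∀ a ∈ s, x a = 0 := fun a ha => by
      have h1 : x a ^ J.card ≤ 0 := by
        refine (h a ha).trans (le_trans (mul_le_mul_of_nonneg_left ?_ hC) h0.ge)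
        exact Finset.prod_le_prod (fun i _ => hc i a)
          fun i _ => Finset.single_le_sum (fun b _ => hc i b) ha
      exact pow_eq_zero_iff hk |>.1 (le_antisymm h1 (pow_nonneg (hx a ha) _))
    rw [Finset.sum_eq_zero this, zero_pow hk]
    exact hP
  -- With each `c i` normalised by its total `T i`, AM-GM bounds `x a / R` by the mean of the `c i a
  -- / T i`, and these means sum to 1 over `s`.
  · set R : ℝ := (C * ∏ i ∈ J, T i) ^ ((J.card : ℝ)⁻¹) with hR
    have hR0 : 0 < R := Real.rpow_pos_of_pos hpos _
    have hRk : R ^ J.card = C * ∏ i ∈ J, T i := Real.rpow_inv_natCast_pow hP hk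
    have hTne : ∀ i ∈ J, T i ≠ 0 := fun i hi h0 => by
      rw [Finset.prod_eq_zero hi h0, mul_zero] at hpos
      exact hpos.false
    have hxa : ∀ a ∈ s, x a ≤ R * ((J.card : ℝ)⁻¹ * ∑ i ∈ J, c i a / T i) := fun a ha => by
      have hnn : 0 ≤ (J.card : ℝ)⁻¹ * ∑ i ∈ J, c i a / T i :=
        mul_nonneg (by positivity) (Finset.sum_nonneg fun i _ => div_nonneg (hc i a) (hT0 i))
      refine le_of_pow_le_pow_left₀ hk (mul_nonneg hR0.le hnn) ?_
      rw [mul_pow, hRk]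
      calc x a ^ J.card ≤ C * ∏ i ∈ J, c i a := h a ha
        _ = (C * ∏ i ∈ J, T i) * ∏ i ∈ J, c i a / T i := by
            rw [mul_assoc, ← Finset.prod_mul_distrib]
            congr 1
            refine Finset.prod_congr rfl fun i hi => ?_
            rw [mul_div_cancel₀ _ (hTne i hi)]
        _ ≤ _ := mul_le_mul_of_nonneg_left
            (prod_le_mean_pow J hJ _ fun i _ => div_nonneg (hc i a) (hT0 i)) hP
    rw [← hRk]
    refine pow_le_pow_left₀ (Finset.sum_nonneg hx) ((Finset.sum_le_sum hxa).trans ?_) _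
    rw [← Finset.mul_sum, ← Finset.mul_sum, Finset.sum_comm]
    have : ∑ i ∈ J, ∑ a ∈ s, c i a / T i = J.card := by
      rw [Finset.sum_congr rfl fun i hi => (Finset.sum_div s (c i) (T i)).symm,
        Finset.sum_congr rfl fun i hi => div_self (hTne i hi)]
      simp
    rw [this, inv_mul_cancel₀ hkR, mul_one]

variable {G A : Type*} [Finite A]

/-- The number of restrictions to `K` of the members of `X`. -/
noncomputable def projCard (X : Set (G → A)) (K : Finset G) : ℕ := (K.restrict '' X).ncard

theorem projCard_mono {X Y : Set (G → A)} (h : X ⊆ Y) (K : Finset G) :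
    projCard X K ≤ projCard Y K :=
  Set.ncard_le_ncard (Set.image_mono h) (Set.toFinite _)

theorem projCard_pos {X : Set (G → A)} (h : X.Nonempty) (K : Finset G) : 0 < projCard X K :=
  (Set.ncard_pos (Set.toFinite _)).2 (h.image _)

theorem projCard_le_pow (X : Set (G → A)) (K : Finset G) :
    projCard X K ≤ Nat.card A ^ K.card := by
  refine (Set.ncard_le_card _).trans ?_
  rw [Nat.card_fun, Nat.card_eq_fintype_card (α := K), Fintype.card_coe]

theorem projCard_eq_sum [Fintype A] (X : Set (G → A)) {K : Finset G} {n : G} (hn : n ∈ K) :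
    projCard X K = ∑ a : A, projCard {x ∈ X | x n = a} K := by
  classical
  have : K.restrict '' X = ⋃ a ∈ (Finset.univ : Finset A), K.restrict '' {x ∈ X | x n = a} := by
    ext y
    simp only [Set.mem_image, Set.mem_iUnion, Set.mem_ofPred_eq, Finset.mem_univ]
    constructor
    · rintro ⟨x, hx, rfl⟩
      exact ⟨x n, trivial, x, ⟨hx, rfl⟩, rfl⟩
    · rintro ⟨a, -, x, ⟨hx, -⟩, rfl⟩
      exact ⟨x, hx, rfl⟩
  unfold projCard
  rw [this]
  simp only [Finset.mem_univ, Set.iUnion_true]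
  rw [Set.ncard_iUnion_of_finite (fun _ => Set.toFinite _), finsum_eq_sum_of_fintype]
  intro a b hab
  refine Set.disjoint_left.2 ?_
  rintro _ ⟨x, ⟨-, hx⟩, rfl⟩ ⟨y, ⟨-, hy⟩, hxy⟩
  exact hab (hx.symm.trans ((congrFun hxy ⟨n, hn⟩).symm.trans hy))

theorem projCard_insert_of_const [DecidableEq G] (X : Set (G → A)) (K : Finset G) (n : G) (a : A) :
    projCard {x ∈ X | x n = a} (insert n K) ≤ projCard {x ∈ X | x n = a} K := by
  refine Set.ncard_le_ncard_of_injOn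
    (fun (y : ↥(insert n K) → A) (i : K) => y ⟨i, Finset.mem_insert_of_mem i.2⟩)
    ?_ ?_ (Set.toFinite _)
  · rintro _ ⟨x, hx, rfl⟩
    exact ⟨x, hx, rfl⟩
  · rintro _ ⟨x, ⟨-, hx⟩, rfl⟩ _ ⟨y, ⟨-, hy⟩, rfl⟩ h
    ext ⟨i, hi⟩
    rcases Finset.mem_insert.1 hi with rfl | hi'
    · exact hx.trans hy.symm
    · exact congrFun h ⟨i, hi'⟩

/-- **Shearer's inequality** for projections: if every element of `K` lies in exactly `k ≥ 1` of the
sets `L i`, then `|X_K| ^ k ≤ ∏ |X_{L i}|`. -/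
theorem projCard_pow_le_prod {ι : Type*} (I : Finset ι) (L : ι → Finset G) {k : ℕ} (hk : k ≠ 0)
    [DecidableEq G] (K : Finset G) (hK : ∀ n ∈ K, (I.filter fun i => n ∈ L i).card = k)
    (X : Set (G → A)) : projCard X K ^ k ≤ ∏ i ∈ I, projCard X (L i) := by
  -- Induction on `K`, fixing the symbol at the new point `n`. Factors with `n ∈ L i` split as sums
  -- over that symbol and are recombined by Hölder; the others are bounded by their values for all
  -- of `X` and form the constant `C`.
  have := Fintype.ofFinite A
  induction K using Finset.induction_on generalizing X with
  | empty =>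
    rcases X.eq_empty_or_nonempty with rfl | hX
    · simp [projCard, hk]
    · have h1 : projCard X ∅ ≤ 1 := (projCard_le_pow X ∅).trans (by simp)
      exact (pow_le_one₀ (Nat.zero_le _) h1).trans
        (Finset.one_le_prod' fun i _ => projCard_pos hX (L i))
  | insert n K _ ih =>
    set J := I.filter fun i => n ∈ L i with hJ
    have hJk : J.card = k := hK n (Finset.mem_insert_self n K)
    set C : ℕ := ∏ i ∈ I.filter fun i => n ∉ L i, projCard X (L i) with hC
    have hsplit : ∏ i ∈ I, projCard X (L i) = C * ∏ i ∈ J, projCard X (L i) := by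
      rw [hC, hJ, mul_comm, Finset.prod_filter_mul_prod_filter_not]
    have hstep : ∀ a : A, projCard {x ∈ X | x n = a} (insert n K) ^ k ≤
        C * ∏ i ∈ J, projCard {x ∈ X | x n = a} (L i) := fun a => by
      refine (Nat.pow_le_pow_left (projCard_insert_of_const X K n a) k).trans ?_
      refine (ih (fun m hm => hK m (Finset.mem_insert_of_mem hm)) _).trans ?_
      rw [hC, hJ, ← Finset.prod_filter_mul_prod_filter_not I (fun i => n ∈ L i), mul_comm]
      exact Nat.mul_le_mul_right _ (Finset.prod_le_prod' fun i _ =>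
        projCard_mono (fun x hx => hx.1) _)
    have key := sum_pow_le_mul_prod_sum J (Finset.card_pos.1 (hJk ▸ Nat.pos_of_ne_zero hk))
      (Finset.univ : Finset A) (fun a => (projCard {x ∈ X | x n = a} (insert n K) : ℝ))
      (fun i a => (projCard {x ∈ X | x n = a} (L i) : ℝ)) C (fun _ _ => Nat.cast_nonneg _)
      (fun _ _ => Nat.cast_nonneg _) (Nat.cast_nonneg _)
      (fun a _ => by rw [hJk]; exact_mod_cast hstep a)
    rw [hsplit, projCard_eq_sum X (Finset.mem_insert_self n K), Finset.prod_congr rfl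
      fun i hi => projCard_eq_sum X (Finset.mem_filter.1 hi).2]
    rw [hJk] at key
    exact_mod_cast key

end Shearer

/-! ### Balls and Følner sequences -/

section Folner

variable {G : Type*} [Group G] {S : Finset G}

theorem exists_word (hS : Subgroup.closure (S : Set G) = ⊤) (g : G) :
    ∃ l : List G, l.length = wordLength S g ∧ (∀ x ∈ l, x ∈ S ∨ x⁻¹ ∈ S) ∧ l.prod = g := by
  have hne : {n | ∃ l : List G, l.length = n ∧ (∀ x ∈ l, x ∈ S ∨ x⁻¹ ∈ S) ∧
      l.prod = g}.Nonempty := by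
    obtain ⟨l, hl, hg⟩ := Submonoid.exists_list_of_mem_closure
      (show g ∈ Submonoid.closure ((S : Set G) ∪ (S : Set G)⁻¹) by
        rw [← Subgroup.closure_toSubmonoid, hS]; trivial)
    exact ⟨l.length, l, rfl, hl, hg⟩
  exact Nat.sInf_mem hne

theorem mem_ball_iff {r : ℕ} {g : G} : g ∈ ball S r ↔ wordLength S g ≤ r := by
  simp [ball, wordDist]

theorem ball_mono {r s : ℕ} (h : r ≤ s) : ball S r ⊆ ball S s :=
  fun _ hg => le_trans (show _ ≤ r from hg) h

theorem one_mem_ball (r : ℕ) : (1 : G) ∈ ball S r := by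
  rw [mem_ball_iff]
  have h : wordLength S (1 : G) ≤ 0 := Nat.sInf_le ⟨[], rfl, by simp, by simp⟩
  exact h.trans (Nat.zero_le r)

theorem ball_finite (hS : Subgroup.closure (S : Set G) = ⊤) (r : ℕ) : (ball S r).Finite := by
  have hT : ((S : Set G) ∪ (S : Set G)⁻¹).Finite := S.finite_toSet.union S.finite_toSet.inv
  have := hT.to_subtype
  refine ((List.finite_length_le ↥((S : Set G) ∪ (S : Set G)⁻¹) r).image
    (fun l => (l.map Subtype.val).prod)).subset fun g hg => ?_
  obtain ⟨l, hl, hlS, rfl⟩ := exists_word hS g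
  have hmem : ∀ x ∈ l, x ∈ (S : Set G) ∪ (S : Set G)⁻¹ := fun x hx => by simpa using hlS x hx
  refine ⟨l.attach.map fun x => (⟨x.1, hmem x.1 x.2⟩ : ↥((S : Set G) ∪ (S : Set G)⁻¹)), ?_, ?_⟩
  · simpa [hl] using mem_ball_iff.1 hg
  · simp [Function.comp_def]

theorem exists_subset_ball (E : Finset G) : ∃ r, (E : Set G) ⊆ ball S r :=
  ⟨E.sup (wordLength S), fun _ hg => mem_ball_iff.2 (Finset.le_sup (f := wordLength S) hg)⟩

-- If `g ∈ F`, some `g * c` has left `F`, so `g` lies in a translate of `Fc ∆ F`; if `g ∉ F`, some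
-- `g * b ∈ F` puts `g` in `Fb⁻¹ \ F`.
open Classical in
theorem boundary_subset (F : Finset G) {r : ℕ} {B : Finset G} (hB : ball S r ⊆ B) :
    boundary S r F ⊆ ((B.biUnion fun b =>
      (symmDiff (F.image (· * b)) F).image (· * b⁻¹) ∪ symmDiff (F.image (· * b⁻¹)) F :
        Finset G) : Set G) := by
  rintro g ⟨⟨b, hb, hbF⟩, c, hc, hcF⟩
  simp only [Finset.coe_biUnion, Set.mem_iUnion, Finset.mem_coe, Finset.mem_union,
    Finset.mem_image, Finset.mem_symmDiff]
  by_cases hg : g ∈ F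
  · exact ⟨c, hB hc, Or.inl ⟨g * c, Or.inl ⟨⟨g, hg, rfl⟩, hcF⟩, by simp⟩⟩
  · exact ⟨b, hB hb, Or.inr (Or.inl ⟨⟨g * b, hbF, by simp⟩, hg⟩)⟩

theorem boundary_finite (hS : Subgroup.closure (S : Set G) = ⊤) (r : ℕ) (F : Finset G) :
    (boundary S r F).Finite := by
  classical
  exact (Finset.finite_toSet _).subset
    (boundary_subset F (B := (ball_finite hS r).toFinset) (by simp))

theorem boundaryRatio_nonneg (r : ℕ) (F : Finset G) : 0 ≤ boundaryRatio S r F := by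
  unfold boundaryRatio
  positivity

theorem boundaryRatio_mono (hS : Subgroup.closure (S : Set G) = ⊤) {r s : ℕ} (h : r ≤ s)
    (F : Finset G) : boundaryRatio S r F ≤ boundaryRatio S s F := by
  have hsub : boundary S r F ⊆ boundary S s F := by
    rintro g ⟨⟨b, hb, hbF⟩, c, hc, hcF⟩
    exact ⟨⟨b, ball_mono h hb, hbF⟩, c, ball_mono h hc, hcF⟩
  have := Set.ncard_le_ncard hsub (boundary_finite hS s F)
  unfold boundaryRatio
  gcongr

theorem exists_boundaryRatio_le (hS : Subgroup.closure (S : Set G) = ⊤) (hG : IsAmenable G)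
    (r : ℕ) {ε : ℝ} (hε : 0 < ε) : ∃ F : Finset G, F.Nonempty ∧ boundaryRatio S r F ≤ ε := by
  classical
  set B : Finset G := (ball_finite hS r).toFinset with hB
  have hBpos : (0 : ℝ) < B.card := by
    have : B.Nonempty := ⟨1, by simpa [hB] using one_mem_ball r⟩
    exact_mod_cast this.card_pos
  -- Each `b ∈ B` contributes two symmetric differences, for `b` and `b⁻¹`; hence the factor `2 *
  -- B.card`.
  obtain ⟨F, hF, h⟩ := hG (B ∪ B.image (·⁻¹)) (ε / (2 * B.card)) (by positivity)
  refine ⟨F, hF, ?_⟩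
  have hF0 : (0 : ℝ) < F.card := by exact_mod_cast hF.card_pos
  rw [boundaryRatio, div_le_iff₀ hF0]
  have h1 := Set.ncard_le_ncard (boundary_subset F (B := B) (S := S) (r := r) (by simp [hB]))
    (Finset.finite_toSet _)
  rw [Set.ncard_coe_finset] at h1
  have h2 : ∀ b ∈ B, ((((symmDiff (F.image (· * b)) F).image (· * b⁻¹) ∪
      symmDiff (F.image (· * b⁻¹)) F).card : ℕ) : ℝ) ≤ ε / B.card * F.card := fun b hb => by
    have h3 := h b (Finset.mem_union_left _ hb)
    have h4 := h b⁻¹ (Finset.mem_union_right _ (Finset.mem_image_of_mem _ hb))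
    have h5 := (Finset.card_union_le ((symmDiff (F.image (· * b)) F).image (· * b⁻¹))
      (symmDiff (F.image (· * b⁻¹)) F)).trans (Nat.add_le_add_right Finset.card_image_le _)
    have h6 : ε / (2 * B.card) * F.card + ε / (2 * B.card) * F.card = ε / B.card * F.card := by
      field_simp
      ring
    rw [← h6]
    refine le_trans (Nat.cast_le.2 h5) ?_
    push_cast
    exact add_le_add h3 h4
  calc ((boundary S r F).ncard : ℝ) ≤ _ := Nat.cast_le.2 (h1.trans Finset.card_biUnion_le)
    _ ≤ ∑ b ∈ B, ε / B.card * F.card := by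
        push_cast
        exact Finset.sum_le_sum h2
    _ = ε * F.card := by
        rw [Finset.sum_const, nsmul_eq_mul]
        field_simp

theorem exists_isFolner (hS : Subgroup.closure (S : Set G) = ⊤) (hG : IsAmenable G) :
    ∃ F : ℕ → Finset G, IsFolner S F := by
  -- Diagonal choice: the radius grows with `n`, so it eventually exceeds any fixed `r`.
  choose F hF hle using fun n : ℕ =>
    exists_boundaryRatio_le hS hG n (ε := 1 / ((n : ℝ) + 1)) Nat.one_div_pos_of_nat
  refine ⟨F, hF, fun r => squeeze_zero' (Eventually.of_forall fun n => boundaryRatio_nonneg r _)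
    ?_ tendsto_one_div_add_atTop_nhds_zero_nat⟩
  filter_upwards [eventually_ge_atTop r] with n hn
  exact (boundaryRatio_mono hS hn _).trans (hle n)

end Folner

/-! ### Entropy as an infimum -/

/-- Shifts close to `X` have no patterns on `K` besides those of `X`. -/
theorem eventually_proj_subset {G A : Type*} [Group G] [TopologicalSpace A] [DiscreteTopology A]
    (X : Shift G A) (K : Finset G) :
    ∀ᶠ Y in 𝓝 X, proj Y K ⊆ proj X K := by
  have hcont : Continuous (K.restrict : (G → A) → (K → A)) := Pi.continuous_domRestrict _
  -- Patterns on a finite window form a discrete space, so agreeing on `K` with some point of `X` is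
  -- an open condition, and Vietoris neighbourhoods detect inclusion in open sets.
  have hU : IsOpen (K.restrict ⁻¹' proj X K : Set (G → A)) :=
    (isOpen_discrete (proj X K)).preimage hcont
  have hV := (TopologicalSpace.NonemptyCompacts.isOpen_subsets_of_isOpen hU).preimage
    (continuous_subtype_val :
      Continuous (Subtype.val : Shift G A → TopologicalSpace.NonemptyCompacts (G → A)))
  filter_upwards [hV.mem_nhds (show X ∈ _ from Set.subset_preimage_image _ _)] with Y hY
  exact Set.image_subset_iff.2 hY

section EntropyBound

variable {G A : Type*} [Group G] [Finite A] [TopologicalSpace A] {S : Finset G}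

theorem ncard_proj_pos (X : Shift G A) (K : Finset G) : 0 < (proj X K).ncard :=
  projCard_pos X.1.nonempty K

theorem entropyRate_nonneg (X : Shift G A) (K : Finset G) : 0 ≤ entropyRate X K :=
  mul_nonneg (by positivity) (Real.log_nonneg (by exact_mod_cast ncard_proj_pos X K))

-- The pattern of `x` on `gE` is determined by the pattern of `g⁻¹x ∈ X` on `E`.
open Classical in
theorem ncard_proj_translate_le (X : Shift G A) (E : Finset G) (g : G) :
    (proj X (E.image (g * ·))).ncard ≤ (proj X E).ncard := by
  have hsub : proj X (E.image (g * ·)) ⊆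
      (fun (y : E → A) (h : E.image (g * ·)) => y ⟨g⁻¹ * h, by
        obtain ⟨e, he, heq⟩ := Finset.mem_image.1 h.2
        rw [← heq]
        simpa using he⟩) '' proj X E := by
    rintro _ ⟨x, hx, rfl⟩
    refine ⟨_, ⟨shiftBy g⁻¹ x, X.2 g⁻¹ x hx, rfl⟩, ?_⟩
    ext h
    simp [shiftBy]
  exact (Set.ncard_le_ncard hsub (Set.toFinite _)).trans (Set.ncard_image_le (Set.toFinite _))

/-- The entropy rate of any nonempty finite set bounds that of sufficiently invariant sets. -/
theorem entropyRate_le_add (hS : Subgroup.closure (S : Set G) = ⊤) (X : Shift G A) {E F : Finset G}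
    (hE : E.Nonempty) (hF : F.Nonempty) {r : ℕ} (hr : (E : Set G) ⊆ ball S r) :
    entropyRate X F ≤ entropyRate X E + boundaryRatio S r F * Real.log (Nat.card A) := by
  classical
  have hA : 1 ≤ Nat.card A := by
    obtain ⟨x, -⟩ := X.1.nonempty
    have : Nonempty A := ⟨x 1⟩
    exact Nat.card_pos
  have hlogA : 0 ≤ Real.log (Nat.card A) := Real.log_nonneg (by exact_mod_cast hA)
  have hlogE : 0 ≤ Real.log (proj X E).ncard :=
    Real.log_nonneg (by exact_mod_cast ncard_proj_pos X E)
  -- `I` consists of the `g` for which `gE` meets `F`; a point `n ∈ F` lies in `gE` exactly when `g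
  -- = n * e⁻¹` with `e ∈ E`.
  set I : Finset G := (F ×ˢ E).image fun p => p.1 * p.2⁻¹ with hI
  set L : G → Finset G := fun g => E.image (g * ·) ∩ F with hL
  have hcover : ∀ n ∈ F, (I.filter fun g => n ∈ L g).card = E.card := fun n hn => by
    have : (I.filter fun g => n ∈ L g) = E.image fun e => n * e⁻¹ := by
      ext g
      simp only [hI, hL, Finset.mem_filter, Finset.mem_image, Finset.mem_inter, Finset.mem_product,
        Prod.exists]
      constructor
      · rintro ⟨-, ⟨e, he, rfl⟩, -⟩
        exact ⟨e, he, by simp⟩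
      · rintro ⟨e, he, rfl⟩
        exact ⟨⟨n, e, ⟨hn, he⟩, rfl⟩, ⟨e, he, by simp⟩, hn⟩
    rw [this, Finset.card_image_of_injective]
    intro a b hab
    simpa using hab
  have hshearer := projCard_pow_le_prod I L hE.card_pos.ne' F hcover (X.1 : Set (G → A))
  set P : G → Prop := fun g => E.image (g * ·) ⊆ F
  have hin : ∀ g ∈ I.filter P, Real.log (projCard (X.1 : Set (G → A)) (L g)) ≤
      Real.log (proj X E).ncard := fun g hg => by
    have hg' : L g = E.image (g * ·) := Finset.inter_eq_left.2 (Finset.mem_filter.1 hg).2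
    rw [hg']
    refine Real.log_le_log (by exact_mod_cast ncard_proj_pos X _) ?_
    exact_mod_cast ncard_proj_translate_le X E g
  have hout : ∀ g ∈ I.filter (¬ P ·), Real.log (projCard (X.1 : Set (G → A)) (L g)) ≤
      E.card * Real.log (Nat.card A) := fun g _ => by
    rw [← Real.log_pow]
    refine Real.log_le_log (by exact_mod_cast ncard_proj_pos X _) ?_
    have h1 : (L g).card ≤ E.card :=
      (Finset.card_le_card Finset.inter_subset_left).trans Finset.card_image_le
    exact_mod_cast (projCard_le_pow _ _).trans (Nat.pow_le_pow_right hA h1)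
  have hcin : (I.filter P).card ≤ F.card := by
    obtain ⟨e, he⟩ := hE
    refine Finset.card_le_card_of_injOn (· * e) (fun g hg => ?_) (fun a _ b _ hab => ?_)
    · exact (Finset.mem_filter.1 hg).2 (Finset.mem_image_of_mem _ he)
    · simpa using hab
  -- Such a `gE` meets both `F` and its complement, and `gE ⊆ g B_r`.
  have hcout : (I.filter (¬ P ·)).card ≤ (boundary S r F).ncard := by
    rw [← Set.ncard_coe_finset]
    refine Set.ncard_le_ncard (fun g hg => ?_) (boundary_finite hS r F)
    obtain ⟨hgI, hgP⟩ := Finset.mem_filter.1 hg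
    obtain ⟨⟨f, e⟩, hfe, rfl⟩ := Finset.mem_image.1 hgI
    obtain ⟨hf, he⟩ := Finset.mem_product.1 hfe
    refine ⟨⟨e, hr he, by simpa using hf⟩, ?_⟩
    obtain ⟨h, hh, hhF⟩ := Finset.not_subset.1 hgP
    obtain ⟨e', he', rfl⟩ := Finset.mem_image.1 hh
    exact ⟨e', hr he', hhF⟩
  have hlog : E.card * Real.log (proj X F).ncard ≤
      F.card * Real.log (proj X E).ncard +
        (boundary S r F).ncard * (E.card * Real.log (Nat.card A)) := by
    calc E.card * Real.log (proj X F).ncard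
        = Real.log ((projCard (X.1 : Set (G → A)) F : ℝ) ^ E.card) := by
          rw [Real.log_pow]; rfl
      _ ≤ Real.log (∏ g ∈ I, (projCard (X.1 : Set (G → A)) (L g) : ℝ)) := by
          refine Real.log_le_log (pow_pos (by exact_mod_cast ncard_proj_pos X F) _) ?_
          exact_mod_cast hshearer
      _ = ∑ g ∈ I, Real.log (projCard (X.1 : Set (G → A)) (L g)) :=
          Real.log_prod fun g _ => by exact_mod_cast (projCard_pos X.1.nonempty (L g)).ne'
      _ = ∑ g ∈ I.filter P, Real.log (projCard (X.1 : Set (G → A)) (L g)) +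
          ∑ g ∈ I.filter (¬ P ·), Real.log (projCard (X.1 : Set (G → A)) (L g)) :=
          (Finset.sum_filter_add_sum_filter_not I P _).symm
      _ ≤ (I.filter P).card * Real.log (proj X E).ncard +
          (I.filter (¬ P ·)).card * (E.card * Real.log (Nat.card A)) := by
          simp only [← nsmul_eq_mul (_ : ℕ) (Real.log (proj X E).ncard),
            ← nsmul_eq_mul (Finset.card (I.filter (¬ P ·)))]
          exact add_le_add (Finset.sum_le_card_nsmul _ _ _ hin)
            (Finset.sum_le_card_nsmul _ _ _ hout)
      _ ≤ _ := by gcongr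
  have hE0 : (0 : ℝ) < E.card := by exact_mod_cast hE.card_pos
  have hF0 : (0 : ℝ) < F.card := by exact_mod_cast hF.card_pos
  unfold entropyRate boundaryRatio
  rw [← mul_le_mul_iff_right₀ (mul_pos hE0 hF0)]
  calc _ = E.card * Real.log (proj X F).ncard := by field_simp
    _ ≤ _ := hlog
    _ = _ := by field_simp

/-- The entropy rates along every Følner sequence converge to the infimum of all entropy rates. -/
theorem tendsto_entropyRate_iInf (hS : Subgroup.closure (S : Set G) = ⊤) (X : Shift G A)
    (F : ℕ → Finset G) (hF : IsFolner S F) :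
    Tendsto (fun n => entropyRate X (F n)) atTop
      (𝓝 (⨅ E : {E : Finset G // E.Nonempty}, entropyRate X E)) := by
  have hbdd : BddBelow (Set.range fun E : {E : Finset G // E.Nonempty} => entropyRate X E) :=
    ⟨0, by rintro _ ⟨E, rfl⟩; exact entropyRate_nonneg X E⟩
  have : Nonempty {E : Finset G // E.Nonempty} := ⟨⟨F 0, hF.1 0⟩⟩
  -- The lower bound is immediate, as each `F n` competes in the infimum; the upper bound compares
  -- `F n` with a nearly optimal `E`.
  refine tendsto_order.2 ⟨fun c hc => Eventually.of_forall fun n =>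
    hc.trans_le (ciInf_le hbdd ⟨F n, hF.1 n⟩), fun c hc => ?_⟩
  obtain ⟨⟨E, hE⟩, hEc⟩ := exists_lt_of_ciInf_lt hc
  obtain ⟨r, hr⟩ := exists_subset_ball (S := S) E
  have hlim : Tendsto (fun n => entropyRate X E +
      boundaryRatio S r (F n) * Real.log (Nat.card A)) atTop (𝓝 (entropyRate X E)) := by
    simpa using ((hF.2 r).mul_const (Real.log (Nat.card A))).const_add (entropyRate X E)
  filter_upwards [hlim.eventually_lt_const hEc] with n hn
  exact (entropyRate_le_add hS X hE (hF.1 n) hr).trans_lt hn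

theorem tendsto_entropyRate (hS : Subgroup.closure (S : Set G) = ⊤) (X : Shift G A)
    (F : ℕ → Finset G) (hF : IsFolner S F) :
    Tendsto (fun n => entropyRate X (F n)) atTop (𝓝 (entropy S X)) := by
  have h : ∃ h : ℝ, ∀ F : ℕ → Finset G, IsFolner S F →
      Tendsto (fun n => entropyRate X (F n)) atTop (𝓝 h) :=
    ⟨_, fun F hF => tendsto_entropyRate_iInf hS X F hF⟩
  exact Classical.epsilon_spec h F hF

/-- Amenability matters here: without a Følner sequence the property defining `entropy` would be
vacuous. -/
theorem entropy_eq_iInf (hS : Subgroup.closure (S : Set G) = ⊤) (hG : IsAmenable G)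
    (X : Shift G A) :
    entropy S X = ⨅ E : {E : Finset G // E.Nonempty}, entropyRate X E := by
  obtain ⟨F, hF⟩ := exists_isFolner hS hG
  exact tendsto_nhds_unique (tendsto_entropyRate hS X F hF) (tendsto_entropyRate_iInf hS X F hF)

theorem eventually_entropyRate_le [DiscreteTopology A] (X : Shift G A) (K : Finset G) :
    ∀ᶠ Y in 𝓝 X, entropyRate Y K ≤ entropyRate X K := by
  filter_upwards [eventually_proj_subset X K] with Y hY
  refine mul_le_mul_of_nonneg_left ?_ (by positivity)
  refine Real.log_le_log (by exact_mod_cast ncard_proj_pos Y K) ?_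
  exact_mod_cast Set.ncard_le_ncard hY (Set.toFinite _)

end EntropyBound

end ShiftEntropy

theorem mainTheorem5 {G A : Type*} [Group G] [Finite A] [TopologicalSpace A] [DiscreteTopology A]
    (S : Finset G) (hS : Subgroup.closure (S : Set G) = ⊤) (hG : ShiftEntropy.IsAmenable G) :
    (∃ F : ℕ → Finset G, ShiftEntropy.IsFolner S F) ∧
    (∀ (X : ShiftEntropy.Shift G A) (F : ℕ → Finset G), ShiftEntropy.IsFolner S F →
      Tendsto (fun n => ShiftEntropy.entropyRate X (F n)) atTop
        (𝓝 (ShiftEntropy.entropy S X))) ∧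
    (∀ X : ShiftEntropy.Shift G A, 0 ≤ ShiftEntropy.entropy S X) ∧
    UpperSemicontinuous (fun X : ShiftEntropy.Shift G A => ShiftEntropy.entropy S X) := by
  refine ⟨ShiftEntropy.exists_isFolner hS hG, ShiftEntropy.tendsto_entropyRate hS, fun X => ?_,
    fun X c hc => ?_⟩
  · rw [ShiftEntropy.entropy_eq_iInf hS hG]
    exact Real.iInf_nonneg fun E => ShiftEntropy.entropyRate_nonneg X E
  · simp only [ShiftEntropy.entropy_eq_iInf hS hG] at hc ⊢
    have : Nonempty {E : Finset G // E.Nonempty} := ⟨⟨{1}, Finset.singleton_nonempty 1⟩⟩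
    -- One window `E` with rate below `c` suffices: it keeps the infimum below `c` for all nearby
    -- shifts.
    obtain ⟨E, hE⟩ := exists_lt_of_ciInf_lt hc
    filter_upwards [ShiftEntropy.eventually_entropyRate_le X E] with Y hY
    exact (ciInf_le ⟨0, by rintro _ ⟨K, rfl⟩; exact ShiftEntropy.entropyRate_nonneg Y K⟩
      E).trans_lt (hY.trans_lt hE)
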